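/- Let $E$ be a finite set with $n$ elements and let $\mu$ be a probability measure on $\{0,1\}^E$, with coordinate variables $X_e$, $e\in E$. Consider the following notions. External field: for $W:E\to[0,\infty)$ with $\sum_x \mu(x)\prod_e W(e)^{x(e)}>0$ (where $0^0=1$), the measure $x\mapsto C\,\mu(x)\prod_{e}W(e)^{x(e)}$, where $C$ is the normalizing constant. Projection: the marginal law of $(X_e)_{e\in S}$ on $\{0,1\}^S$, for $S\subseteq E$. NA: for every $A\subseteq E$ and all increasing $f:\{0,1\}^A\to\mathbb R$, $g:\{0,1\}^{E\setminus A}\to\mathbb R$, $\mathbf E[f(X_A)\,g(X_{E\setminus A})]\le \mathbf E f(X_A)\,\mathbf E g(X_{E\setminus A})$. CNA: every law obtained from $\mu$ by conditioning on the values of some (or none) of the variables, these values having positive probability, is NA. JNRD: for every $A\subseteq E$ and every up-set $H\subseteq\{0,1\}^A$, the conditional probability $\mu(X_A\in H\mid X_{E\setminus A}=y)$ is weakly decreasing in $y$, for the coordinatewise order on those $y\in\{0,1\}^{E\setminus A}$ which have positive probability. Negative lattice condition (NLC): $\mu(x\vee y)\,\mu(x\wedge y)\le\mu(x)\,\mu(y)$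 for all $x,y\in\{0,1\}^E$. h-NLC: every projection of $\mu$ satisfies NLC. CNA+, JNRD+, h-NLC+: respectively CNA, JNRD, h-NLC holds for $\mu$ and for every measure obtained from $\mu$ by imposing an external field and then projecting. Ultra-log-concavity (ULC) of the rank sequence $a_k=\mu\big(\sum_e X_e=k\big)$, $0\le k\le n$: the set of $k$ with $a_k\neq0$ is an interval of integers, and $q_k=a_k/\binom nk$ satisfies $q_k^2\ge q_{k-1}q_{k+1}$ for $1\le k\le n-1$. Theorem. Suppose that the variables $X_e$ are exchangeable, i.e. that their joint law $\mu$ is invariant under all permutations of $E$. Then the following eight conditions are equivalent: CNA+, JNRD+, h-NLC+, CNA, JNRD, h-NLC, ULC of the rank sequence $(a_k)_{0\le k\le n}$, and NLC. -/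

import Mathlib

noncomputable section

namespace NegDep

universe u

variable {E : Type u} [Fintype E] [DecidableEq E]

/-- `μ` is a probability measure (given by its mass function) on the Boolean lattice `{0,1}^E`. -/
def IsProb (μ : (E → Bool) → ℝ) : Prop :=
  (∀ x, 0 ≤ μ x) ∧ ∑ x, μ x = 1

/-- The probability `μ(s)` of an event. -/
def prob (μ : (E → Bool) → ℝ) (s : Set (E → Bool)) : ℝ :=
  ∑ x, s.indicator μ x

/-- The expectation of `F` under `μ`. -/
def expect (μ : (E → Bool) → ℝ) (F : (E → Bool) → ℝ) : ℝ :=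
  ∑ x, μ x * F x

/-- The conditional probability `μ(s | t)`; only used when `μ(t) > 0`. -/
def condProb (μ : (E → Bool) → ℝ) (s t : Set (E → Bool)) : ℝ :=
  prob μ (s ∩ t) / prob μ t

/-- The projection of `μ` onto `{0,1}^S`. -/
def project (μ : (E → Bool) → ℝ) (S : Finset E) : (S → Bool) → ℝ :=
  fun y => prob μ {x | S.restrict x = y}

/-- The event that `X_e = η e` for all `e ∈ A`. -/
def agree (A : Finset E) (η : E → Bool) : Set (E → Bool) :=
  {x | ∀ e ∈ A, x e = η e}

/-- The conditional law of `μ` given `X_e = η e` for all `e ∈ A`; only used when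
that event has positive probability. -/
def condition (μ : (E → Bool) → ℝ) (A : Finset E) (η : E → Bool) : (E → Bool) → ℝ :=
  fun x => (agree A η).indicator μ x / prob μ (agree A η)

/-- The unnormalized reweighting `∏ e, W(e)^{x(e)} · μ(x)`. -/
def reweight (μ : (E → Bool) → ℝ) (W : E → ℝ) : (E → Bool) → ℝ :=
  fun x => (∏ e, if x e = true then W e else 1) * μ x

/-- The measure obtained from `μ` by imposing the external field `W`; only used when
the total mass of the reweighting is positive. -/
def externalField (μ : (E → Bool) → ℝ) (W : E → ℝ) : (E → Bool) → ℝ :=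
  fun x => reweight μ W x / ∑ y, reweight μ W y

/-- `W` is a nonnegative weight function whose external field can be imposed on `μ`. -/
def IsField (μ : (E → Bool) → ℝ) (W : E → ℝ) : Prop :=
  (∀ e, 0 ≤ W e) ∧ 0 < ∑ y, reweight μ W y

/-- Negative association. -/
def NA (μ : (E → Bool) → ℝ) : Prop :=
  ∀ (A : Finset E) (f : (A → Bool) → ℝ) (g : ((Aᶜ : Finset E) → Bool) → ℝ),
    Monotone f → Monotone g →
      expect μ (fun x => f (A.restrict x) * g (Aᶜ.restrict x)) ≤
        expect μ (fun x => f (A.restrict x)) * expect μ (fun x => g (Aᶜ.restrict x))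

/-- Conditional negative association: every law obtained by conditioning on the values of
some (or none) of the variables is negatively associated. -/
def CNA (μ : (E → Bool) → ℝ) : Prop :=
  ∀ (A : Finset E) (η : E → Bool), 0 < prob μ (agree A η) → NA (condition μ A η)

/-- Joint negative regression dependence: for every `A` and every increasing event `H` of
`{0,1}^A`, the conditional probability of `H` given `X_e`, `e ∉ A`, is decreasing in the values
conditioned on (among those of positive probability). -/
def JNRD (μ : (E → Bool) → ℝ) : Prop :=
  ∀ (A : Finset E) (H : Set (A → Bool)), IsUpperSet H →
    ∀ y y' : (Aᶜ : Finset E) → Bool, y ≤ y' →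
      0 < prob μ {x | Aᶜ.restrict x = y} → 0 < prob μ {x | Aᶜ.restrict x = y'} →
        condProb μ {x | A.restrict x ∈ H} {x | Aᶜ.restrict x = y'} ≤
          condProb μ {x | A.restrict x ∈ H} {x | Aᶜ.restrict x = y}

/-- The negative lattice condition. -/
def NLC (μ : (E → Bool) → ℝ) : Prop :=
  ∀ x y : E → Bool, μ (x ⊔ y) * μ (x ⊓ y) ≤ μ x * μ y

/-- The hereditary negative lattice condition: every projection satisfies `NLC`. -/
def HNLC (μ : (E → Bool) → ℝ) : Prop :=
  ∀ S : Finset E, NLC (project μ S)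

/-- `CNA+`: `CNA` holds for `μ` and for all measures obtained from `μ` by imposing an external
field and then projecting. -/
def CNAPlus (μ : (E → Bool) → ℝ) : Prop :=
  CNA μ ∧ ∀ (W : E → ℝ) (S : Finset E), IsField μ W → CNA (project (externalField μ W) S)

/-- `JNRD+`: `JNRD` holds for `μ` and for all measures obtained from `μ` by imposing an external
field and then projecting. -/
def JNRDPlus (μ : (E → Bool) → ℝ) : Prop :=
  JNRD μ ∧ ∀ (W : E → ℝ) (S : Finset E), IsField μ W → JNRD (project (externalField μ W) S)

/-- `h-NLC+`: `h-NLC` holds for `μ` and for all measures obtained from `μ` by imposing an external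
field and then projecting. -/
def HNLCPlus (μ : (E → Bool) → ℝ) : Prop :=
  HNLC μ ∧ ∀ (W : E → ℝ) (S : Finset E), IsField μ W → HNLC (project (externalField μ W) S)

/-- The coordinate variables are exchangeable under `μ`. -/
def Exchangeable (μ : (E → Bool) → ℝ) : Prop :=
  ∀ (σ : Equiv.Perm E) (x : E → Bool), μ (x ∘ σ) = μ x

/-- The rank sequence `a_k = μ(∑ X_e = k)`. -/
def rankSeq (μ : (E → Bool) → ℝ) (k : ℕ) : ℝ :=
  prob μ {x | (Finset.univ.filter fun e => x e = true).card = k}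

/-- Ultra-log-concavity of the finite sequence `a_0, …, a_n` of nonnegative reals: the indices of
the nonzero terms form an interval, and `a_k / C(n,k)` is log-concave. -/
def ULC (n : ℕ) (a : ℕ → ℝ) : Prop :=
  (∀ k ≤ n, 0 ≤ a k) ∧ {k | k ≤ n ∧ a k ≠ 0}.OrdConnected ∧
    ∀ k, k + 2 ≤ n →
      (a k / (n.choose k : ℝ)) * (a (k + 2) / (n.choose (k + 2) : ℝ)) ≤
        (a (k + 1) / (n.choose (k + 1) : ℝ)) ^ 2

end NegDep

end

/-! By exchangeability μ(x) = q(|x|), where |x| is the number of ones, and ULC of the rank sequence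
says exactly that q is log-concave without internal zeros. That condition is the hub of the
equivalence.

From the hub to the strong properties: exchangeability is lost under external fields, so one works
in the larger class of measures (product weight) × r(|x|) with r log-concave
(`IsWeightedSymmetric`). It is closed under external fields, conditioning and projection, and each
member satisfies NLC and JNRD, and NA when normalized. The engine is `level_mono`: under a product
weight, the mean of an increasing function given the rank increases with the rank. Two blocks of
coordinates interact only through r(i+j), whose 2×2 minors have the negative sign, and
`sum_mul_sum_le_of_cross` combines these monotonicities.

Back to the hub: NLC, JNRD and CNA are each tested on configurations u ≤ v and one or two
coordinates where they differ. -/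

namespace NegDep

open Finset

universe u

/-! ### Product weights times a log-concave function of the rank -/

section WeightedSymmetric

variable {E : Type u} [Fintype E]

/-- The number of ones of a configuration. -/
def cnt {E : Type*} [Fintype E] (x : E → Bool) : ℕ := ∑ e, if x e = true then 1 else 0

/-- The product weight of a configuration. -/
def wt {E : Type*} [Fintype E] (W : E → Bool → ℝ) (x : E → Bool) : ℝ := ∏ e, W e (x e)

/-- A nonnegative log-concave sequence without internal zeros. -/
def LogConcave (r : ℕ → ℝ) : Prop :=
  (∀ k, 0 ≤ r k) ∧ ∀ k a b, r k * r (k + a + b) ≤ r (k + a) * r (k + b)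

/-- A product weight times a log-concave function of the number of ones. -/
def IsWeightedSymmetric {E : Type*} [Fintype E] (μ : (E → Bool) → ℝ) : Prop :=
  ∃ (W : E → Bool → ℝ) (r : ℕ → ℝ), (∀ e b, 0 ≤ W e b) ∧ LogConcave r ∧
    ∀ x, μ x = wt W x * r (cnt x)

theorem wt_nonneg {W : E → Bool → ℝ} (hW : ∀ e b, 0 ≤ W e b) (x : E → Bool) : 0 ≤ wt W x :=
  Finset.prod_nonneg fun e _ => hW e (x e)

theorem cnt_eq_card (x : E → Bool) : cnt x = (univ.filter fun e => x e = true).card := by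
  rw [cnt, Finset.card_filter]

theorem cnt_le_card (x : E → Bool) : cnt x ≤ Fintype.card E := by
  rw [cnt_eq_card]; exact Finset.card_le_univ _

theorem cnt_mono {x y : E → Bool} (h : x ≤ y) : cnt x ≤ cnt y := by
  rw [cnt_eq_card, cnt_eq_card]
  refine Finset.card_le_card fun e he => ?_
  simp only [Finset.mem_filter, Finset.mem_univ, true_and] at he ⊢
  have := h e
  rw [he] at this
  exact top_le_iff.1 this

/-- The number of coordinates at which `y` is one and `x` is zero. -/
def excess {E : Type*} [Fintype E] (x y : E → Bool) : ℕ :=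
  (univ.filter fun e => x e = false ∧ y e = true).card

theorem excess_add_cnt (x y : E → Bool) : excess x y + cnt x = excess y x + cnt y := by
  unfold excess cnt
  rw [Finset.card_filter, Finset.card_filter, ← Finset.sum_add_distrib, ← Finset.sum_add_distrib]
  refine Finset.sum_congr rfl fun e _ => ?_
  cases x e <;> cases y e <;> rfl

theorem LogConcave.mul_const {r : ℕ → ℝ} (h : LogConcave r) {c : ℝ} (hc : 0 ≤ c) :
    LogConcave fun k => r k * c := by
  refine ⟨fun k => mul_nonneg (h.1 k) hc, fun k a b => ?_⟩
  have := mul_le_mul_of_nonneg_right (h.2 k a b) (mul_nonneg hc hc)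
  nlinarith [this]

theorem IsWeightedSymmetric.nonneg {μ : (E → Bool) → ℝ} (h : IsWeightedSymmetric μ)
    (x : E → Bool) : 0 ≤ μ x := by
  obtain ⟨W, r, hW, hr, hμ⟩ := h
  rw [hμ]
  exact mul_nonneg (wt_nonneg hW x) (hr.1 _)

/-- Serves both external fields and conditioning: each multiplies by single-site factors, and zero
factors are allowed, so indicators of prescribed values qualify. -/
theorem IsWeightedSymmetric.mul_prod {μ ν : (E → Bool) → ℝ} (h : IsWeightedSymmetric μ)
    {V : E → Bool → ℝ} (hV : ∀ e b, 0 ≤ V e b) {c : ℝ} (hc : 0 ≤ c)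
    (hν : ∀ x, ν x = wt V x * μ x / c) : IsWeightedSymmetric ν := by
  obtain ⟨W, r, hW, hr, hμ⟩ := h
  refine ⟨fun e b => V e b * W e b, fun k => r k * c⁻¹, fun e b => mul_nonneg (hV e b) (hW e b),
    hr.mul_const (inv_nonneg.2 hc), fun x => ?_⟩
  rw [hν, hμ, wt, wt, wt, Finset.prod_mul_distrib, div_eq_mul_inv]
  ring

/-- The product weight is multiplicatively modular and the rank additively so; only log-concavity of
`r` at the four ranks remains. -/
theorem IsWeightedSymmetric.NLC {μ : (E → Bool) → ℝ} (h : IsWeightedSymmetric μ) : NLC μ := by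
  obtain ⟨W, r, hW, hr, hμ⟩ := h
  intro x y
  have hw : wt W (x ⊔ y) * wt W (x ⊓ y) = wt W x * wt W y := by
    unfold wt
    rw [← Finset.prod_mul_distrib, ← Finset.prod_mul_distrib]
    refine Finset.prod_congr rfl fun e _ => ?_
    cases hx : x e <;> cases hy : y e <;> simp [hx, hy, mul_comm]
  have hc : cnt (x ⊔ y) + cnt (x ⊓ y) = cnt x + cnt y := by
    unfold cnt
    rw [← Finset.sum_add_distrib, ← Finset.sum_add_distrib]
    refine Finset.sum_congr rfl fun e _ => ?_
    cases hx : x e <;> cases hy : y e <;> simp [hx, hy]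
  have h1 : cnt (x ⊓ y) ≤ cnt x := cnt_mono inf_le_left
  have h2 : cnt (x ⊓ y) ≤ cnt y := cnt_mono inf_le_right
  have h3 := hr.2 (cnt (x ⊓ y)) (cnt x - cnt (x ⊓ y)) (cnt y - cnt (x ⊓ y))
  rw [show cnt (x ⊓ y) + (cnt x - cnt (x ⊓ y)) + (cnt y - cnt (x ⊓ y)) = cnt (x ⊔ y) by omega,
    Nat.add_sub_cancel' h1, Nat.add_sub_cancel' h2] at h3
  have h4 := mul_le_mul_of_nonneg_left h3 (mul_nonneg (wt_nonneg hW x) (wt_nonneg hW y))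
  rw [hμ, hμ, hμ, hμ]
  linear_combination h4 + r (cnt (x ⊓ y)) * r (cnt (x ⊔ y)) * hw

variable [DecidableEq E]

theorem cnt_update_true {x : E → Bool} {e : E} (h : x e = false) :
    cnt (Function.update x e true) = cnt x + 1 := by
  unfold cnt
  rw [← Finset.add_sum_erase _ _ (Finset.mem_univ e), ← Finset.add_sum_erase univ
    (fun e => if x e = true then 1 else 0) (Finset.mem_univ e)]
  have : ∀ e' ∈ univ.erase e, (if Function.update x e true e' = true then 1 else 0) =
      (if x e' = true then 1 else 0) := by
    intro e' he'
    rw [Function.update_of_ne (Finset.ne_of_mem_erase he')]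
  rw [Finset.sum_congr rfl this]
  simp [h, add_comm]

theorem cnt_update_false {x : E → Bool} {e : E} (h : x e = true) :
    cnt (Function.update x e false) + 1 = cnt x := by
  have := cnt_update_true (x := Function.update x e false) (e := e) (by simp)
  rw [← this, Function.update_idem, ← h, Function.update_eq_self]

/-! ### Log-concave sequences -/

theorem LogConcave.of_step {r : ℕ → ℝ} (h0 : ∀ k, 0 ≤ r k)
    (h : ∀ k b, r k * r (k + 1 + b) ≤ r (k + 1) * r (k + b)) : LogConcave r := by
  refine ⟨h0, fun k a => ?_⟩
  induction a generalizing k with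
  | zero => intro b; simp
  | succ a ih =>
    intro b
    cases b with
    | zero => simp [mul_comm]
    | succ b =>
      have h1 := h k (a + b + 1)
      have h2 := ih (k + 1) b
      have e1 : k + (a + 1) + (b + 1) = k + 1 + (a + b + 1) := by ring
      have e2 : k + (a + b + 1) = k + 1 + a + b := by ring
      have e3 : k + (a + 1) = k + 1 + a := by ring
      have e4 : k + (b + 1) = k + 1 + b := by ring
      rw [e1, e3, e4]
      rw [e2] at h1
      exact h1.trans h2

/-- Multiplying consecutive local inequalities telescopes; interval support makes the common factors
positive, so that they cancel. -/
theorem LogConcave.of_ordConnected {r : ℕ → ℝ} (h0 : ∀ k, 0 ≤ r k)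
    (hc : {k | r k ≠ 0}.OrdConnected) (h : ∀ k, r k * r (k + 2) ≤ r (k + 1) ^ 2) :
    LogConcave r := by
  refine .of_step h0 fun k b => ?_
  induction b with
  | zero => simp [mul_comm]
  | succ b ih =>
    by_cases hk : r k = 0
    · rw [hk, zero_mul]; exact mul_nonneg (h0 _) (h0 _)
    by_cases hb : r (k + 1 + (b + 1)) = 0
    · rw [hb, mul_zero]; exact mul_nonneg (h0 _) (h0 _)
    have p1 : r (k + b) ≠ 0 := hc.out hk hb ⟨by omega, by omega⟩
    have p2 : r (k + 1 + b) ≠ 0 := hc.out hk hb ⟨by omega, by omega⟩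
    have p1' := lt_of_le_of_ne (h0 _) p1.symm
    have p2' := lt_of_le_of_ne (h0 _) p2.symm
    have h3 := h (k + b)
    rw [show k + b + 2 = k + 1 + (b + 1) by ring, show k + b + 1 = k + 1 + b by ring] at h3
    rw [show k + (b + 1) = k + 1 + b by ring]
    have h4 := mul_le_mul ih h3 (mul_nonneg (h0 _) (h0 _)) (mul_nonneg (h0 _) (h0 _))
    refine le_of_mul_le_mul_right ?_ (mul_pos p1' p2')
    nlinarith [h4]

theorem LogConcave.ordConnected {r : ℕ → ℝ} (h : LogConcave r) :
    {k | r k ≠ 0}.OrdConnected := by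
  refine ⟨fun i hi l hl j hj h0 => ?_⟩
  have h1 := h.2 i (j - i) (l - j)
  have e1 : i + (j - i) = j := by have := hj.1; omega
  have e2 : j + (l - j) = l := by have := hj.2; omega
  rw [e1, e2, h0, zero_mul] at h1
  have := mul_pos (lt_of_le_of_ne (h.1 i) (Ne.symm hi)) (lt_of_le_of_ne (h.1 l) (Ne.symm hl))
  linarith

theorem LogConcave.cross {r : ℕ → ℝ} (h : LogConcave r) {i i' j j' : ℕ} (hi : i ≤ i')
    (hj : j ≤ j') : r (i + j) * r (i' + j') ≤ r (i + j') * r (i' + j) := by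
  have := h.2 (i + j) (j' - j) (i' - i)
  rwa [show i + j + (j' - j) + (i' - i) = i' + j' by omega,
    show i + j + (j' - j) = i + j' by omega, show i + j + (i' - i) = i' + j by omega] at this

/-- This is the effect of summing out one coordinate. After expansion, the `v²`, `w²` and `vw` terms
are each dominated by log-concavity of `r`. -/
theorem LogConcave.add_shift {r : ℕ → ℝ} (h : LogConcave r) {v w : ℝ} (hv : 0 ≤ v) (hw : 0 ≤ w) :
    LogConcave fun k => v * r k + w * r (k + 1) := by
  refine .of_step (fun k => add_nonneg (mul_nonneg hv (h.1 _)) (mul_nonneg hw (h.1 _)))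
    fun k b => ?_
  cases b with
  | zero => simp [mul_comm]
  | succ b =>
    have h1 := mul_le_mul_of_nonneg_left (h.2 k 1 (b + 1)) (mul_nonneg hv hv)
    have h2 := mul_le_mul_of_nonneg_left (h.2 (k + 1) 1 (b + 1)) (mul_nonneg hw hw)
    have h3 := mul_le_mul_of_nonneg_left (h.2 k 1 (b + 1 + 1)) (mul_nonneg hv hw)
    have h4 := mul_le_mul_of_nonneg_left (h.2 (k + 1) 1 b) (mul_nonneg hv hw)
    rw [show k + 1 + (b + 1) + 1 = k + 1 + 1 + (b + 1) by ring,
      show k + (b + 1) + 1 = k + 1 + (b + 1) by ring]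
    rw [show k + 1 + (b + 1 + 1) = k + 1 + 1 + (b + 1) by ring,
      show k + (b + 1 + 1) = k + 1 + (b + 1) by ring] at h3
    rw [show k + 1 + 1 + b = k + 1 + (b + 1) by ring,
      show k + 1 + b = k + (b + 1) by ring] at h4
    nlinarith [h1, h2, h3, h4]

theorem wt_option {F : Type*} [Fintype F] (W : Option F → Bool → ℝ) (x : Option F → Bool) :
    wt W x = W none (x none) * wt (fun a => W (some a)) fun a => x (some a) :=
  Fintype.prod_option _

theorem cnt_option {F : Type*} [Fintype F] (x : Option F → Bool) :
    cnt x = (if x none = true then 1 else 0) + cnt fun a => x (some a) :=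
  Fintype.sum_option _

/-- Gives closure under projection: coordinates are summed out one at a time by
`LogConcave.add_shift`. -/
theorem LogConcave.sum_wt {F : Type*} [Fintype F] [DecidableEq F] {r : ℕ → ℝ} (h : LogConcave r)
    {W : F → Bool → ℝ} (hW : ∀ e b, 0 ≤ W e b) :
    LogConcave fun k => ∑ z : F → Bool, wt W z * r (k + cnt z) := by
  suffices H : ∀ (F : Type _) [Fintype F], ∀ (D : DecidableEq F) (W : F → Bool → ℝ),
      (∀ e b, 0 ≤ W e b) → LogConcave fun k => ∑ z : F → Bool, wt W z * r (k + cnt z) from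
    H F _ W hW
  clear hW W
  refine @Fintype.induction_empty_option _ ?_ ?_ ?_
  · intro α β _ e ih D W hW
    let _ := Fintype.ofEquiv β e.symm
    classical
    have := ih (Classical.decEq α) (fun a => W (e a)) (fun a => hW _)
    convert this using 2 with k
    symm
    refine Fintype.sum_equiv (Equiv.arrowCongr e (Equiv.refl Bool)) _ _ fun z => ?_
    have h1 : wt W (Equiv.arrowCongr e (Equiv.refl Bool) z) = wt (fun a => W (e a)) z := by
      unfold wt
      exact (Fintype.prod_equiv e _ _ fun a => by simp [Equiv.arrowCongr]).symm
    have h2 : cnt (Equiv.arrowCongr e (Equiv.refl Bool) z) = cnt z := by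
      unfold cnt
      exact (Fintype.sum_equiv e _ _ fun a => by simp [Equiv.arrowCongr]).symm
    rw [h1, h2]
  · intro D W _
    simpa [wt, cnt] using h
  · intro α _ ih D W hW
    classical
    have h1 := (ih (Classical.decEq α) (fun a => W (some a)) (fun a => hW _)).add_shift
      (hW none false) (hW none true)
    convert h1 using 2 with k
    rw [Fintype.sum_equiv (Equiv.piOptionEquivProd (α := α) (β := fun _ => Bool)) _
      (fun p => wt W ((Equiv.piOptionEquivProd (β := fun _ => Bool)).symm p) *
        r (k + cnt ((Equiv.piOptionEquivProd (β := fun _ => Bool)).symm p)))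
      (fun z => by rw [Equiv.symm_apply_apply]),
      Fintype.sum_prod_type, Fintype.sum_bool, add_comm, Finset.mul_sum, Finset.mul_sum]
    congr 1 <;> refine Finset.sum_congr (by congr!) fun z _ => ?_
    · rw [wt_option, cnt_option]
      simp [Equiv.piOptionEquivProd, mul_assoc]
    · rw [wt_option, cnt_option]
      simp [Equiv.piOptionEquivProd, mul_assoc, add_assoc]

/-! ### Conditional means given the rank -/

theorem excess_update {x y : E → Bool} {e : E} (hx : x e = false) (hy : y e = true) :
    excess (Function.update x e true) (Function.update y e false) + 1 = excess x y := by
  unfold excess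
  have hm : e ∈ univ.filter fun e => x e = false ∧ y e = true := by simp [hx, hy]
  rw [← Finset.card_erase_add_one hm]
  congr 2
  ext e'
  by_cases h : e' = e
  · subst h; simp
  · simp [h]

theorem wt_swap (W : E → Bool → ℝ) {x y : E → Bool} {e : E} (hx : x e = false)
    (hy : y e = true) : wt W (Function.update y e false) * wt W (Function.update x e true) =
      wt W x * wt W y := by
  unfold wt
  rw [← Finset.prod_mul_distrib, ← Finset.prod_mul_distrib]
  refine Finset.prod_congr rfl fun e' _ => ?_
  by_cases h : e' = e
  · subst h; simp [hx, hy]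
  · simp [h, mul_comm]

/-- The weighted sum of `f` over the configurations with `i` ones. -/
def level (W : E → Bool → ℝ) (f : (E → Bool) → ℝ) (i : ℕ) : ℝ :=
  ∑ x with cnt x = i, wt W x * f x

theorem level_one_nonneg {W : E → Bool → ℝ} (hW : ∀ e b, 0 ≤ W e b) (i : ℕ) :
    0 ≤ level W 1 i :=
  Finset.sum_nonneg fun x _ => mul_nonneg (wt_nonneg hW x) zero_le_one

theorem wt_eq_zero_of_level {W : E → Bool → ℝ} (hW : ∀ e b, 0 ≤ W e b) {i : ℕ}
    (h : level W 1 i = 0) {x : E → Bool} (hx : cnt x = i) : wt W x = 0 := by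
  have := (Finset.sum_eq_zero_iff_of_nonneg fun x _ =>
    mul_nonneg (wt_nonneg hW x) zero_le_one).1 h x (by simp [hx])
  simpa using this

theorem level_eq_zero {W : E → Bool → ℝ} (hW : ∀ e b, 0 ≤ W e b) {i : ℕ}
    (h : level W 1 i = 0) (f : (E → Bool) → ℝ) : level W f i = 0 := by
  refine Finset.sum_eq_zero fun x hx => ?_
  rw [wt_eq_zero_of_level hW h (by simpa using hx), zero_mul]

/-- A configuration `y` of rank `k + 1` can pass a one to some `x` of rank `i` with nonzero weight.
The product of weights is preserved, but `y` has dropped to rank `k`, where weights vanish. -/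
theorem level_succ_eq_zero {W : E → Bool → ℝ} (hW : ∀ e b, 0 ≤ W e b) {i k : ℕ} (hik : i ≤ k)
    (hi : level W 1 i ≠ 0) (hk : level W 1 k = 0) : level W 1 (k + 1) = 0 := by
  obtain ⟨x, hx, hx0⟩ := Finset.exists_ne_zero_of_sum_ne_zero hi
  refine Finset.sum_eq_zero fun y hy => ?_
  simp only [Finset.mem_filter, Finset.mem_univ, true_and] at hx hy
  have h1 := excess_add_cnt x y
  have h2 : 0 < excess x y := by omega
  obtain ⟨e, he⟩ := Finset.card_pos.1 h2
  simp only [Finset.mem_filter, Finset.mem_univ, true_and] at he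
  have h3 := cnt_update_false he.2
  have h4 := wt_eq_zero_of_level hW hk (x := Function.update y e false) (by omega)
  have h5 := wt_swap W he.1 he.2
  rw [h4, zero_mul] at h5
  have h6 : wt W x ≠ 0 := fun h => hx0 (by rw [h, zero_mul])
  rw [(mul_eq_zero.1 h5.symm).resolve_left h6, zero_mul]

/-- Exchange argument: for `x` of rank `i` and `y` of rank `i + 1`, pick `e` uniformly among the
coordinates where `y` is one and `x` is zero. Replacing (x, y) by (y without e, x with e) preserves
the weight, so `f y` may be traded for `f` of x with e, which is at least `f x`. -/
theorem level_step {W : E → Bool → ℝ} (hW : ∀ e b, 0 ≤ W e b) {f : (E → Bool) → ℝ}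
    (hf : Monotone f) (i : ℕ) : level W f i * level W 1 (i + 1) ≤
      level W f (i + 1) * level W 1 i := by
  set P : Finset ((E → Bool) × (E → Bool)) :=
    univ.filter (fun x : E → Bool => cnt x = i) ×ˢ univ.filter fun y : E → Bool => cnt y = i + 1
    with hP
  set T : (E → Bool) × (E → Bool) → Finset E :=
    fun p => univ.filter fun e => p.1 e = false ∧ p.2 e = true with hT
  have hcard : ∀ p, (T p).card = excess p.1 p.2 := fun p => rfl
  have hpos : ∀ p ∈ P, ((T p).card : ℝ) ≠ 0 := by
    intro p hp
    simp only [hP, Finset.mem_product, Finset.mem_filter, Finset.mem_univ, true_and] at hp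
    have := excess_add_cnt p.1 p.2
    rw [hcard]
    have : 0 < excess p.1 p.2 := by omega
    positivity
  -- Spread the term of each pair evenly over its exchangeable coordinates.
  have expand : ∀ F : (E → Bool) × (E → Bool) → ℝ,
      ∑ p ∈ P, F p = ∑ q ∈ P.sigma T, F q.1 / (T q.1).card := by
    intro F
    rw [Finset.sum_sigma]
    refine Finset.sum_congr rfl fun p hp => ?_
    dsimp only
    rw [Finset.sum_const, nsmul_eq_mul, mul_div_cancel₀ _ (hpos p hp)]
  have hL : level W f i * level W 1 (i + 1) = ∑ p ∈ P, wt W p.1 * wt W p.2 * f p.1 := by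
    rw [level, level, Finset.sum_mul_sum, ← Finset.sum_product']
    exact Finset.sum_congr rfl fun p _ => by simp; ring
  have hR : level W f (i + 1) * level W 1 i = ∑ p ∈ P, wt W p.1 * wt W p.2 * f p.2 := by
    rw [mul_comm, level, level, Finset.sum_mul_sum, ← Finset.sum_product']
    exact Finset.sum_congr rfl fun p _ => by simp; ring
  rw [hL, hR, expand, expand]
  have hmem : ∀ q ∈ P.sigma T,
      (⟨(Function.update q.1.2 q.2 false, Function.update q.1.1 q.2 true), q.2⟩ :
        (_ : (E → Bool) × (E → Bool)) × E) ∈ P.sigma T := by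
    rintro ⟨⟨x, y⟩, e⟩ hq
    simp only [hP, hT, Finset.mem_sigma, Finset.mem_product, Finset.mem_filter, Finset.mem_univ,
      true_and] at hq ⊢
    obtain ⟨⟨h1, h2⟩, h3, h4⟩ := hq
    have := cnt_update_true h3
    have := cnt_update_false h4
    refine ⟨⟨by omega, by omega⟩, by simp, by simp⟩
  have hinv : ∀ q ∈ P.sigma T, Function.update (Function.update q.1.1 q.2 true) q.2 false = q.1.1 ∧
      Function.update (Function.update q.1.2 q.2 false) q.2 true = q.1.2 := by
    rintro ⟨⟨x, y⟩, e⟩ hq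
    simp only [hT, Finset.mem_sigma, Finset.mem_filter, Finset.mem_univ, true_and] at hq ⊢
    obtain ⟨-, h3, h4⟩ := hq
    constructor
    · rw [Function.update_idem, ← h3, Function.update_eq_self]
    · rw [Function.update_idem, ← h4, Function.update_eq_self]
  calc ∑ q ∈ P.sigma T, wt W q.1.1 * wt W q.1.2 * f q.1.1 / (T q.1).card
      ≤ ∑ q ∈ P.sigma T, wt W q.1.1 * wt W q.1.2 * f (Function.update q.1.1 q.2 true) /
          (T q.1).card := by
        refine Finset.sum_le_sum fun q _ => ?_
        refine div_le_div_of_nonneg_right (mul_le_mul_of_nonneg_left (hf ?_) ?_) (Nat.cast_nonneg _)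
        · exact le_update_iff.2 ⟨Bool.le_true _, fun _ _ => le_rfl⟩
        · exact mul_nonneg (wt_nonneg hW _) (wt_nonneg hW _)
    _ = ∑ q ∈ P.sigma T, wt W q.1.1 * wt W q.1.2 * f q.1.2 / (T q.1).card := by
        refine Finset.sum_nbij'
          (fun q => ⟨(Function.update q.1.2 q.2 false, Function.update q.1.1 q.2 true), q.2⟩)
          (fun q => ⟨(Function.update q.1.2 q.2 false, Function.update q.1.1 q.2 true), q.2⟩)
          hmem hmem ?_ ?_ ?_
        · intro q hq
          obtain ⟨h1, h2⟩ := hinv q hq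
          simp only [h1, h2]
        · intro q hq
          obtain ⟨h1, h2⟩ := hinv q hq
          simp only [h1, h2]
        · rintro ⟨⟨x, y⟩, e⟩ hq
          simp only [hP, hT, Finset.mem_sigma, Finset.mem_product, Finset.mem_filter,
            Finset.mem_univ, true_and] at hq
          obtain ⟨⟨h1, h2⟩, h3, h4⟩ := hq
          have h5 := excess_update h3 h4
          have h6 := excess_add_cnt (Function.update y e false) (Function.update x e true)
          have h7 := cnt_update_true h3
          have h8 := cnt_update_false h4
          rw [hcard, hcard]
          dsimp only
          -- The set of exchangeable coordinates changes under the swap, but its size does not, so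
          -- the uniform factor is preserved.
          rw [wt_swap W h3 h4, show excess (Function.update y e false) (Function.update x e true) =
            excess x y by omega]

theorem level_mono {W : E → Bool → ℝ} (hW : ∀ e b, 0 ≤ W e b) {f : (E → Bool) → ℝ}
    (hf : Monotone f) {i k : ℕ} (hik : i ≤ k) :
    level W f i * level W 1 k ≤ level W f k * level W 1 i := by
  by_cases hi : level W 1 i = 0
  · rw [hi, level_eq_zero hW hi]; simp
  have hi' := lt_of_le_of_ne (level_one_nonneg hW i) (Ne.symm hi)
  induction k, hik using Nat.le_induction with
  | base => exact le_rfl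
  | succ k hk ih =>
    by_cases h0 : level W 1 k = 0
    · have := level_succ_eq_zero hW hk hi h0
      rw [this, level_eq_zero hW this]; simp
    have h0' := lt_of_le_of_ne (level_one_nonneg hW k) (Ne.symm h0)
    have h1 := mul_le_mul_of_nonneg_right ih (level_one_nonneg hW (k + 1))
    have h2 := mul_le_mul_of_nonneg_right (level_step hW hf k) hi'.le
    refine le_of_mul_le_mul_right ?_ h0'
    nlinarith [h1, h2]

theorem sum_wt_eq_sum_level (W : E → Bool → ℝ) (f : (E → Bool) → ℝ) (c : ℕ → ℝ) {N : ℕ}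
    (hN : Fintype.card E < N) :
    ∑ x, wt W x * f x * c (cnt x) = ∑ i ∈ range N, level W f i * c i := by
  rw [← Finset.sum_fiberwise_of_maps_to (s := univ) (t := range N) (g := cnt)
    (fun x _ => Finset.mem_range.2 ((cnt_le_card x).trans_lt hN))]
  refine Finset.sum_congr rfl fun i _ => ?_
  rw [level, Finset.sum_mul]
  refine Finset.sum_congr rfl fun x hx => ?_
  rw [(Finset.mem_filter.1 hx).2]

/-! ### Splitting configurations into two blocks -/

/-- The configuration with restrictions `y` to `A` and `z` to the complement of `A`. -/
def glue (A : Finset E) (y : A → Bool) (z : (Aᶜ : Finset E) → Bool) : E → Bool :=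
  fun e => if h : e ∈ A then y ⟨e, h⟩ else z ⟨e, Finset.mem_compl.2 h⟩

theorem glue_apply_mem {A : Finset E} (y : A → Bool) (z : (Aᶜ : Finset E) → Bool) (e : A) :
    glue A y z e = y e := by
  simp [glue]

theorem glue_apply_compl {A : Finset E} (y : A → Bool) (z : (Aᶜ : Finset E) → Bool)
    (e : (Aᶜ : Finset E)) : glue A y z e = z e := by
  have := Finset.mem_compl.1 e.2
  simp [glue, this]

theorem restrict_glue (A : Finset E) (y : A → Bool) (z : (Aᶜ : Finset E) → Bool) :
    A.restrict (glue A y z) = y :=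
  funext fun e => glue_apply_mem y z e

theorem restrict_compl_glue (A : Finset E) (y : A → Bool) (z : (Aᶜ : Finset E) → Bool) :
    (Aᶜ).restrict (glue A y z) = z :=
  funext fun e => glue_apply_compl y z e

theorem glue_restrict (A : Finset E) (x : E → Bool) :
    glue A (A.restrict x) ((Aᶜ).restrict x) = x := by
  ext e
  by_cases h : e ∈ A <;> simp [glue, h]

theorem sum_glue (A : Finset E) (F : (E → Bool) → ℝ) :
    ∑ x, F x = ∑ y, ∑ z, F (glue A y z) := by
  rw [← Fintype.sum_prod_type']
  refine Finset.sum_nbij' (fun x => (A.restrict x, (Aᶜ).restrict x)) (fun p => glue A p.1 p.2)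
    (fun _ _ => Finset.mem_univ _) (fun _ _ => Finset.mem_univ _) (fun x _ => glue_restrict A x)
    (fun p _ => ?_) (fun x _ => ?_)
  · rw [restrict_glue, restrict_compl_glue]
  · rw [glue_restrict]

theorem wt_glue (A : Finset E) (W : E → Bool → ℝ) (y : A → Bool) (z : (Aᶜ : Finset E) → Bool) :
    wt W (glue A y z) = wt (fun e : A => W e) y * wt (fun e : (Aᶜ : Finset E) => W e) z := by
  unfold wt
  rw [← Finset.prod_mul_prod_compl A, ← Finset.prod_coe_sort A, ← Finset.prod_coe_sort Aᶜ]
  simp only [glue_apply_mem, glue_apply_compl]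

theorem cnt_glue (A : Finset E) (y : A → Bool) (z : (Aᶜ : Finset E) → Bool) :
    cnt (glue A y z) = cnt y + cnt z := by
  unfold cnt
  rw [← Finset.sum_add_sum_compl A, ← Finset.sum_coe_sort A, ← Finset.sum_coe_sort Aᶜ]
  simp only [glue_apply_mem, glue_apply_compl]

theorem prob_eq_sum_ite (μ : (E → Bool) → ℝ) (p : (E → Bool) → Prop) [DecidablePred p] :
    prob μ {x | p x} = ∑ x, if p x then μ x else 0 := by
  unfold prob
  refine Finset.sum_congr rfl fun x _ => ?_
  simp [Set.indicator_apply]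

theorem project_eq (μ : (E → Bool) → ℝ) (S : Finset E) (y : S → Bool) :
    project μ S y = ∑ z, μ (glue S y z) := by
  rw [project, prob_eq_sum_ite, sum_glue S]
  simp only [restrict_glue]
  rw [Finset.sum_eq_single y]
  · simp
  · intro b _ hb; simp [hb]
  · simp

theorem prob_restrict_compl (μ : (E → Bool) → ℝ) (A : Finset E) (H : Set (A → Bool))
    [DecidablePred (· ∈ H)] (y : (Aᶜ : Finset E) → Bool) :
    prob μ ({x | A.restrict x ∈ H} ∩ {x | (Aᶜ).restrict x = y}) =
      ∑ w, if w ∈ H then μ (glue A w y) else 0 := by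
  rw [← Set.ofPred_and, prob_eq_sum_ite, sum_glue A]
  simp only [restrict_glue, restrict_compl_glue]
  refine Finset.sum_congr rfl fun w _ => ?_
  rw [Finset.sum_eq_single y]
  · simp
  · intro b _ hb; simp [hb]
  · simp

/-! ### Negative association and regression dependence -/

theorem sum_sum_nonneg_of_symm {s : Finset ℕ} {G : ℕ → ℕ → ℝ}
    (h : ∀ i j, i ≤ j → 0 ≤ G i j + G j i) : 0 ≤ ∑ i ∈ s, ∑ j ∈ s, G i j := by
  have h1 : ∑ i ∈ s, ∑ j ∈ s, G i j = ∑ i ∈ s, ∑ j ∈ s, G j i := Finset.sum_comm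
  have h2 : 0 ≤ ∑ i ∈ s, ∑ j ∈ s, (G i j + G j i) := by
    refine Finset.sum_nonneg fun i _ => Finset.sum_nonneg fun j _ => ?_
    rcases le_total i j with hij | hij
    · exact h i j hij
    · rw [add_comm]; exact h j i hij
  simp only [Finset.sum_add_distrib] at h2
  linarith

/-- Chebyshev's sum inequality in cross-multiplied form. Symmetrizing the difference of the two
sides in (i, j) yields the product (α j a i − α i a j)(d i c j − c i d j), nonnegative for i ≤ j. -/
theorem sum_mul_sum_le_of_cross {s : Finset ℕ} {α a c d : ℕ → ℝ}
    (h1 : ∀ i j, i ≤ j → α i * a j ≤ α j * a i) (h2 : ∀ i j, i ≤ j → c i * d j ≤ d i * c j) :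
    (∑ i ∈ s, α i * d i) * (∑ i ∈ s, a i * c i) ≤
      (∑ i ∈ s, α i * c i) * ∑ i ∈ s, a i * d i := by
  have := sum_sum_nonneg_of_symm (s := s)
    (G := fun i j => α i * c i * (a j * d j) - α i * d i * (a j * c j)) fun i j hij => by
      have := mul_nonneg (sub_nonneg.2 (h1 i j hij)) (sub_nonneg.2 (h2 i j hij))
      nlinarith [this]
  simp only [Finset.sum_sub_distrib] at this
  rw [Finset.sum_mul_sum, Finset.sum_mul_sum]
  linarith

theorem expect_mul_eq {μ : (E → Bool) → ℝ} {W : E → Bool → ℝ} {r : ℕ → ℝ}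
    (hμ : ∀ x, μ x = wt W x * r (cnt x)) (A : Finset E) (f : (A → Bool) → ℝ)
    (g : ((Aᶜ : Finset E) → Bool) → ℝ) :
    expect μ (fun x => f (A.restrict x) * g ((Aᶜ).restrict x)) =
      ∑ i ∈ range (Fintype.card E + 1), level (fun e : A => W e) f i *
        ∑ j ∈ range (Fintype.card E + 1),
          level (fun e : (Aᶜ : Finset E) => W e) g j * r (i + j) := by
  have card_lt : ∀ B : Finset E, Fintype.card B < Fintype.card E + 1 := fun B => by
    rw [Fintype.card_coe]; exact Nat.lt_succ_of_le (Finset.card_le_univ B)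
  rw [← sum_wt_eq_sum_level _ f (fun i => ∑ j ∈ range (Fintype.card E + 1),
    level (fun e : (Aᶜ : Finset E) => W e) g j * r (i + j)) (card_lt A), expect, sum_glue A]
  refine Finset.sum_congr rfl fun y _ => ?_
  rw [← sum_wt_eq_sum_level _ g (fun j => r (cnt y + j)) (card_lt Aᶜ), Finset.mul_sum]
  refine Finset.sum_congr rfl fun z _ => ?_
  rw [hμ, restrict_glue, restrict_compl_glue, wt_glue, cnt_glue]
  ring

/-- Given that block `A` has rank i, the mean of `f` increases with i while that of `g` decreases;
Chebyshev then applies. The total mass makes the inequality homogeneous, so no normalization is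
needed. -/
theorem IsWeightedSymmetric.expect_mul_le {μ : (E → Bool) → ℝ} (h : IsWeightedSymmetric μ)
    (A : Finset E) {f : (A → Bool) → ℝ} {g : ((Aᶜ : Finset E) → Bool) → ℝ} (hf : Monotone f)
    (hg : Monotone g) :
    expect μ (fun x => f (A.restrict x) * g ((Aᶜ).restrict x)) * ∑ x, μ x ≤
      expect μ (fun x => f (A.restrict x)) * expect μ (fun x => g ((Aᶜ).restrict x)) := by
  obtain ⟨W, r, hW, hr, hμ⟩ := h
  have e1 := expect_mul_eq hμ A f g
  have e2 := expect_mul_eq hμ A f 1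
  have e3 := expect_mul_eq hμ A 1 g
  have e4 := expect_mul_eq hμ A 1 1
  simp only [Pi.one_apply, mul_one, one_mul] at e2 e3 e4
  have e5 : ∑ x, μ x = expect μ (fun _ => 1) := by simp [expect]
  rw [e5, e1, e2, e3, e4]
  refine sum_mul_sum_le_of_cross (fun i j hij =>
    level_mono (W := fun e : A => W e) (fun e b => hW e b) hf hij)
    fun i i' hi => ?_
  -- What remains is that the mean of `g` decreases in the rank of block `A`: a second use of the
  -- same inequality, now over the ranks of the complement.
  rw [mul_comm]
  refine sum_mul_sum_le_of_cross (fun i j hij =>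
    level_mono (W := fun e : (Aᶜ : Finset E) => W e) (fun e b => hW e b) hg hij)
    fun j j' hj => ?_
  rw [mul_comm (r (i' + j))]
  exact hr.cross hi hj

theorem IsWeightedSymmetric.NA {μ : (E → Bool) → ℝ} (h : IsWeightedSymmetric μ)
    (h1 : ∑ x, μ x = 1) : NA μ := by
  intro A f g hf hg
  simpa [h1] using h.expect_mul_le A hf hg

/-- Once the weight of `y` cancels, the conditional law on `A` depends on `y` only through its rank,
which shifts the argument of `r` and so tilts the law towards lower ranks. -/
theorem IsWeightedSymmetric.JNRD {μ : (E → Bool) → ℝ} (h : IsWeightedSymmetric μ) : JNRD μ := by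
  classical
  intro A H hH y y' hy h0 h0'
  obtain ⟨W, r, hW, hr, hμ⟩ := h
  set V : (Aᶜ : Finset E) → Bool → ℝ := fun e => W e
  set U : A → Bool → ℝ := fun e => W e
  have key : ∀ (H : Set (A → Bool)) (y : (Aᶜ : Finset E) → Bool),
      prob μ ({x | A.restrict x ∈ H} ∩ {x | (Aᶜ).restrict x = y}) = wt V y *
        ∑ i ∈ range (Fintype.card A + 1), level U (H.indicator 1) i * r (cnt y + i) := by
    intro H y
    rw [prob_restrict_compl, ← sum_wt_eq_sum_level U (H.indicator 1) (fun i => r (cnt y + i))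
      (Nat.lt_succ_self _), Finset.mul_sum]
    refine Finset.sum_congr rfl fun w _ => ?_
    rw [hμ, wt_glue, cnt_glue, add_comm (cnt w), Set.indicator_apply]
    split_ifs
    · simp only [Pi.one_apply]; ring
    · simp
  have key1 := key Set.univ
  simp only [Set.mem_univ, Set.ofPred_true, Set.univ_inter, Set.indicator_univ] at key1
  unfold condProb
  rw [key, key]
  rw [key1] at h0 h0' ⊢
  rw [key1]
  have hpos : ∀ z : (Aᶜ : Finset E) → Bool, 0 < wt V z *
      ∑ i ∈ range (Fintype.card A + 1), level U 1 i * r (cnt z + i) → 0 < wt V z ∧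
      0 < ∑ i ∈ range (Fintype.card A + 1), level U 1 i * r (cnt z + i) := by
    intro z hz
    have h1 : 0 ≤ wt V z := wt_nonneg (W := V) (fun e b => hW e b) z
    exact ⟨lt_of_le_of_ne h1 fun h => by rw [← h, zero_mul] at hz; exact hz.false,
      pos_of_mul_pos_right hz h1⟩
  obtain ⟨a1, a2⟩ := hpos y h0
  obtain ⟨b1, b2⟩ := hpos y' h0'
  rw [mul_div_mul_left _ _ a1.ne', mul_div_mul_left _ _ b1.ne', div_le_div_iff₀ b2 a2]
  refine sum_mul_sum_le_of_cross (fun i j hij => level_mono (W := U) (fun e b => hW e b) ?_ hij)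
    fun j j' hj => ?_
  · intro w w' hw
    by_cases h1 : w ∈ H
    · rw [Set.indicator_of_mem h1, Set.indicator_of_mem (hH hw h1)]; exact le_rfl
    · rw [Set.indicator_of_notMem h1]
      exact Set.indicator_nonneg (fun _ _ => zero_le_one) _
  · rw [mul_comm (r (cnt y' + j))]
    exact hr.cross (cnt_mono hy) hj

/-! ### Closure properties and their consequences -/

theorem IsWeightedSymmetric.project {μ : (E → Bool) → ℝ} (h : IsWeightedSymmetric μ)
    (S : Finset E) : IsWeightedSymmetric (project μ S) := by
  obtain ⟨W, r, hW, hr, hμ⟩ := h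
  refine ⟨fun e => W e, _, fun e b => hW e b,
    hr.sum_wt (W := fun e : (Sᶜ : Finset E) => W e) (fun e b => hW e b), fun y => ?_⟩
  rw [project_eq, Finset.mul_sum]
  refine Finset.sum_congr rfl fun z _ => ?_
  rw [hμ, wt_glue, cnt_glue, mul_assoc]

theorem IsWeightedSymmetric.externalField {μ : (E → Bool) → ℝ} (h : IsWeightedSymmetric μ)
    {W : E → ℝ} (hW : IsField μ W) : IsWeightedSymmetric (externalField μ W) := by
  refine h.mul_prod (V := fun e b => if b = true then W e else 1) (fun e b => ?_) hW.2.le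
    fun x => rfl
  split_ifs
  · exact hW.1 e
  · exact zero_le_one

theorem IsWeightedSymmetric.condition {μ : (E → Bool) → ℝ} (h : IsWeightedSymmetric μ)
    (A : Finset E) (η : E → Bool) : IsWeightedSymmetric (condition μ A η) := by
  classical
  refine h.mul_prod (V := fun e b => if e ∈ A → b = η e then 1 else 0) (fun e b => ?_)
    (c := prob μ (agree A η)) ?_ fun x => ?_
  · split_ifs
    · exact zero_le_one
    · exact le_rfl
  · exact Finset.sum_nonneg fun x _ => Set.indicator_nonneg (fun x _ => h.nonneg x) x
  · unfold NegDep.condition wt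
    congr 1
    rw [Set.indicator_apply]
    split_ifs with hx
    · rw [Finset.prod_eq_one, one_mul]
      intro e _
      exact if_pos fun he => hx e he
    · simp only [agree, Set.mem_ofPred_eq, not_forall] at hx
      obtain ⟨e, he, hne⟩ := hx
      rw [Finset.prod_eq_zero (Finset.mem_univ e), zero_mul]
      exact if_neg fun h => hne (h he)

theorem sum_condition {μ : (E → Bool) → ℝ} {A : Finset E} {η : E → Bool}
    (h : 0 < prob μ (agree A η)) : ∑ x, condition μ A η x = 1 := by
  unfold condition
  rw [← Finset.sum_div]
  exact div_self h.ne'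

theorem IsWeightedSymmetric.CNA {μ : (E → Bool) → ℝ} (h : IsWeightedSymmetric μ) : CNA μ :=
  fun A η h0 => (h.condition A η).NA (sum_condition h0)

theorem IsWeightedSymmetric.HNLC {μ : (E → Bool) → ℝ} (h : IsWeightedSymmetric μ) : HNLC μ :=
  fun S => (h.project S).NLC

theorem IsWeightedSymmetric.CNAPlus {μ : (E → Bool) → ℝ} (h : IsWeightedSymmetric μ) :
    CNAPlus μ :=
  ⟨h.CNA, fun _ S hW => ((h.externalField hW).project S).CNA⟩

theorem IsWeightedSymmetric.JNRDPlus {μ : (E → Bool) → ℝ} (h : IsWeightedSymmetric μ) :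
    JNRDPlus μ :=
  ⟨h.JNRD, fun _ S hW => ((h.externalField hW).project S).JNRD⟩

theorem IsWeightedSymmetric.HNLCPlus {μ : (E → Bool) → ℝ} (h : IsWeightedSymmetric μ) :
    HNLCPlus μ :=
  ⟨h.HNLC, fun _ S hW => ((h.externalField hW).project S).HNLC⟩

end WeightedSymmetric

/-! ### Profiles of exchangeable measures -/

section Exchangeable

variable {E : Type u} [Fintype E]

theorem not_true_le_false : ¬true ≤ false := by decide

theorem excess_eq_zero {x y : E → Bool} (h : x ≤ y) : excess y x = 0 := by
  rw [excess, Finset.card_eq_zero, Finset.filter_eq_empty_iff]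
  rintro e - ⟨h1, h2⟩
  have := h e
  rw [h1, h2] at this
  exact not_true_le_false this

/-- `q` is the profile of `μ`: the mass of a configuration is `q` of its number of ones. -/
structure IsProfile (μ : (E → Bool) → ℝ) (q : ℕ → ℝ) : Prop where
  eq : ∀ x, μ x = q (cnt x)
  nonneg : ∀ k, 0 ≤ q k
  eq_zero : ∀ k, Fintype.card E < k → q k = 0

theorem IsProfile.isWeightedSymmetric {μ : (E → Bool) → ℝ} {q : ℕ → ℝ} (h : IsProfile μ q)
    (hq : LogConcave q) : IsWeightedSymmetric μ :=
  ⟨fun _ _ => 1, q, fun _ _ => zero_le_one, hq, fun x => by simp [wt, h.eq]⟩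

theorem exists_le_cnt_eq {i l : ℕ} (hil : i ≤ l) (hl : l ≤ Fintype.card E) :
    ∃ u v : E → Bool, u ≤ v ∧ cnt u = i ∧ cnt v = l := by
  classical
  obtain ⟨T, -, hT⟩ := Finset.exists_subset_card_eq (s := (univ : Finset E)) hl
  obtain ⟨S, hST, hS⟩ := Finset.exists_subset_card_eq (s := T) (hT ▸ hil)
  refine ⟨fun e => decide (e ∈ S), fun e => decide (e ∈ T), fun e => ?_, ?_, ?_⟩
  · by_cases h : e ∈ S
    · simp [h, hST h]
    · simp [h]
  · rw [cnt_eq_card, ← hS]; congr 1; ext; simp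
  · rw [cnt_eq_card, ← hT]; congr 1; ext; simp

theorem Exchangeable.eq_of_cnt_eq {μ : (E → Bool) → ℝ} (h : Exchangeable μ) {x y : E → Bool}
    (hxy : cnt x = cnt y) : μ x = μ y := by
  rw [cnt_eq_card, cnt_eq_card, ← Fintype.card_subtype, ← Fintype.card_subtype] at hxy
  obtain ⟨σ⟩ := Fintype.card_eq.1 hxy.symm
  rw [← h σ.extendSubtype x]
  congr 1
  ext e
  by_cases he : y e = true
  · simp [he, σ.extendSubtype_mem e he]
  · simpa [he] using σ.extendSubtype_not_mem e he

theorem Exchangeable.exists_isProfile {μ : (E → Bool) → ℝ} (h : Exchangeable μ)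
    (h0 : ∀ x, 0 ≤ μ x) : ∃ q, IsProfile μ q := by
  classical
  -- The value 0 at unattained ranks makes log-concavity on all of ℕ equivalent to the finite
  -- condition up to the number of coordinates.
  refine ⟨fun k => if hk : ∃ x : E → Bool, cnt x = k then μ hk.choose else 0,
    fun x => ?_, fun k => ?_, fun k hk => ?_⟩
  · have hx : ∃ y : E → Bool, cnt y = cnt x := ⟨x, rfl⟩
    rw [dif_pos hx]
    exact h.eq_of_cnt_eq hx.choose_spec.symm
  · split_ifs
    · exact h0 _
    · exact le_rfl
  · rw [dif_neg]
    rintro ⟨x, rfl⟩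
    exact (cnt_le_card x).not_gt hk

theorem exists_pair_of_two_le {i l : ℕ} (hil : i + 2 ≤ l) (hl : l ≤ Fintype.card E) :
    ∃ (u v : E → Bool) (e e' : E), u ≤ v ∧ e ≠ e' ∧ u e = false ∧ u e' = false ∧ v e = true ∧
      v e' = true ∧ cnt u = i ∧ cnt v = l := by
  obtain ⟨u, v, huv, hu, hv⟩ := exists_le_cnt_eq (E := E) (i := i) (l := l) (by omega) hl
  have h1 := excess_add_cnt u v
  obtain ⟨e, he, e', he', hne⟩ := Finset.one_lt_card.1 (show 1 < excess u v by omega)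
  simp only [Finset.mem_filter, Finset.mem_univ, true_and] at he he'
  exact ⟨u, v, e, e', huv, hne, he.1, he'.1, he.2, he'.2, hu, hv⟩

/-- The coordinates at which two configurations agree. -/
def agreeSet (u v : E → Bool) : Finset E := univ.filter fun e => u e = v e

/-- Conditioning on the common values of `u ≤ v` confines the measure to the interval between them.
-/
theorem le_of_mem_agree {u v x : E → Bool} (huv : u ≤ v) (hx : x ∈ agree (agreeSet u v) u) :
    u ≤ x ∧ x ≤ v := by
  have key : ∀ e, u e ≤ x e ∧ x e ≤ v e := by
    intro e
    by_cases he : u e = v e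
    · have := hx e (by simp [agreeSet, he])
      rw [this]
      exact ⟨le_rfl, huv e⟩
    · have := huv e
      cases h1 : u e <;> cases h2 : v e <;> simp_all [not_true_le_false]
  exact ⟨fun e => (key e).1, fun e => (key e).2⟩

variable [DecidableEq E]

theorem card_filter_cnt_eq (k : ℕ) :
    (univ.filter fun x : E → Bool => cnt x = k).card = (Fintype.card E).choose k := by
  rw [← Finset.card_univ, ← Finset.card_powersetCard]
  refine Finset.card_nbij' (fun x => univ.filter fun e => x e = true) (fun T e => decide (e ∈ T))
    (fun x hx => ?_) (fun T hT => ?_) (fun x _ => ?_) (fun T _ => ?_)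
  · simpa [Finset.mem_powersetCard, cnt_eq_card] using hx
  · simpa [Finset.mem_powersetCard, cnt_eq_card] using hT
  · ext e; simp
  · ext e; simp

theorem IsProfile.rankSeq_eq {μ : (E → Bool) → ℝ} {q : ℕ → ℝ} (h : IsProfile μ q) (k : ℕ) :
    rankSeq μ k = (Fintype.card E).choose k * q k := by
  rw [rankSeq, prob_eq_sum_ite, ← card_filter_cnt_eq, ← nsmul_eq_mul, ← Finset.sum_const,
    Finset.sum_filter]
  refine Finset.sum_congr rfl fun x _ => ?_
  rw [← cnt_eq_card]
  split_ifs with hx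
  · rw [h.eq, hx]
  · rfl

theorem IsProfile.rankSeq_div {μ : (E → Bool) → ℝ} {q : ℕ → ℝ} (h : IsProfile μ q) {k : ℕ}
    (hk : k ≤ Fintype.card E) : rankSeq μ k / ((Fintype.card E).choose k : ℝ) = q k := by
  have := Nat.choose_pos hk
  rw [h.rankSeq_eq, mul_div_cancel_left₀]
  positivity

theorem IsProfile.setOf_ne_zero {μ : (E → Bool) → ℝ} {q : ℕ → ℝ} (h : IsProfile μ q) :
    {k | k ≤ Fintype.card E ∧ rankSeq μ k ≠ 0} = {k | q k ≠ 0} := by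
  ext k
  simp only [Set.mem_ofPred_eq, h.rankSeq_eq]
  constructor
  · exact fun hk h0 => hk.2 (by rw [h0, mul_zero])
  · intro hk
    have hkn : k ≤ Fintype.card E := not_lt.1 fun h1 => hk (h.eq_zero k h1)
    exact ⟨hkn, mul_ne_zero (Nat.cast_ne_zero.2 (Nat.choose_pos hkn).ne') hk⟩

theorem IsProfile.ULC_iff {μ : (E → Bool) → ℝ} {q : ℕ → ℝ} (h : IsProfile μ q) :
    ULC (Fintype.card E) (rankSeq μ) ↔ LogConcave q := by
  rw [ULC, h.setOf_ne_zero]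
  constructor
  · rintro ⟨-, hc, hs⟩
    refine .of_ordConnected h.nonneg hc fun k => ?_
    by_cases hk : k + 2 ≤ Fintype.card E
    · have := hs k hk
      rwa [h.rankSeq_div (by omega), h.rankSeq_div hk, h.rankSeq_div (by omega)] at this
    · rw [h.eq_zero (k + 2) (not_le.1 hk), mul_zero]
      positivity
  · intro hq
    refine ⟨fun k _ => ?_, hq.ordConnected, fun k hk => ?_⟩
    · rw [h.rankSeq_eq]; exact mul_nonneg (Nat.cast_nonneg _) (h.nonneg k)
    · rw [h.rankSeq_div (by omega), h.rankSeq_div hk, h.rankSeq_div (by omega), sq]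
      exact hq.2 k 1 1

/-! ### Log-concavity of the profile from NLC or JNRD -/

theorem exists_update_pair (k b : ℕ) (h : k + 1 + b ≤ Fintype.card E) :
    ∃ (u v : E → Bool) (e : E), u ≤ v ∧ u e = false ∧ v e = true ∧ cnt u = k ∧
      cnt v = k + 1 + b ∧ cnt (Function.update u e true) = k + 1 ∧
      cnt (Function.update v e false) = k + b := by
  obtain ⟨u, v, huv, hu, hv⟩ := exists_le_cnt_eq (E := E) (i := k) (l := k + 1 + b) (by omega) h
  have h1 := excess_add_cnt u v
  obtain ⟨e, he⟩ := Finset.card_pos.1 (show 0 < excess u v by omega)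
  simp only [Finset.mem_filter, Finset.mem_univ, true_and] at he
  have h2 := cnt_update_true he.1
  have h3 := cnt_update_false he.2
  exact ⟨u, v, e, huv, he.1, he.2, hu, hv, by omega, by omega⟩

theorem IsProfile.logConcave_of_NLC {μ : (E → Bool) → ℝ} {q : ℕ → ℝ} (h : IsProfile μ q)
    (hN : NLC μ) : LogConcave q := by
  refine .of_step h.nonneg fun k b => ?_
  by_cases hk : k + 1 + b ≤ Fintype.card E
  · obtain ⟨u, v, e, huv, hue, hve, hu, hv, hu', hv'⟩ := exists_update_pair k b hk
    -- These two have meet `u` and join `v`. Since the gap `b` is arbitrary, the absence of internal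
    -- zeros needs no separate argument.
    have h1 := hN (Function.update u e true) (Function.update v e false)
    have hsup : Function.update u e true ⊔ Function.update v e false = v := by
      ext e'
      by_cases he : e' = e
      · subst he; simp [hve]
      · have := huv e'
        simp [he, sup_eq_right.2 this]
    have hinf : Function.update u e true ⊓ Function.update v e false = u := by
      ext e'
      by_cases he : e' = e
      · subst he; simp [hue]
      · have := huv e'
        simp [he, inf_eq_left.2 this]
    rw [hsup, hinf, h.eq, h.eq, h.eq, h.eq, hu, hv, hu', hv'] at h1
    linarith
  · rw [h.eq_zero _ (not_le.1 hk), mul_zero]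
    exact mul_nonneg (h.nonneg _) (h.nonneg _)

theorem glue_singleton (e : E) (w : ({e} : Finset E) → Bool) (x : E → Bool) :
    glue {e} w (({e}ᶜ : Finset E).restrict x) =
      Function.update x e (w ⟨e, Finset.mem_singleton_self e⟩) := by
  ext e'
  by_cases he : e' = e
  · subst he; simp [glue]
  · simp [glue, he]

theorem prob_restrict_compl_singleton (μ : (E → Bool) → ℝ) (e : E) (p : Bool → Prop)
    [DecidablePred p] (x : E → Bool) :
    prob μ ({z | ({e} : Finset E).restrict z ∈ {w : ({e} : Finset E) → Bool |
        p (w ⟨e, Finset.mem_singleton_self e⟩)}} ∩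
      {z | ({e}ᶜ : Finset E).restrict z = ({e}ᶜ : Finset E).restrict x}) =
    (if p true then μ (Function.update x e true) else 0) +
      if p false then μ (Function.update x e false) else 0 := by
  classical
  rw [prob_restrict_compl]
  simp only [glue_singleton, Set.mem_ofPred_eq]
  rw [← Fintype.sum_bool fun b => if p b then μ (Function.update x e b) else 0]
  exact Fintype.sum_equiv (Equiv.funUnique ({e} : Finset E) Bool) _ _ fun w => rfl

/-- Given j ones off `e`, the conditional probability of a one at `e` is q(j+1)/(q(j)+q(j+1)).
Comparing j = k with j = k + b and clearing denominators gives the step inequality. -/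
theorem IsProfile.logConcave_of_JNRD {μ : (E → Bool) → ℝ} {q : ℕ → ℝ} (h : IsProfile μ q)
    (hJ : JNRD μ) : LogConcave q := by
  refine .of_step h.nonneg fun k b => ?_
  by_cases hk0 : q k = 0
  · rw [hk0, zero_mul]; exact mul_nonneg (h.nonneg _) (h.nonneg _)
  by_cases hb0 : q (k + 1 + b) = 0
  · rw [hb0, mul_zero]; exact mul_nonneg (h.nonneg _) (h.nonneg _)
  have hk : k + 1 + b ≤ Fintype.card E := not_lt.1 fun h1 => hb0 (h.eq_zero _ h1)
  obtain ⟨u, v, e, huv, hue, hve, hu, hv, hu', hv'⟩ := exists_update_pair k b hk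
  have hu'' : cnt (Function.update u e false) = k := by rw [← hue, Function.update_eq_self, hu]
  have hv'' : cnt (Function.update v e true) = k + 1 + b := by
    rw [← hve, Function.update_eq_self, hv]
  have key := fun x => prob_restrict_compl_singleton μ e (fun b => b = true) x
  have key' := fun x => prob_restrict_compl_singleton μ e (fun _ => True) x
  simp only [if_true, Set.ofPred_true, Set.mem_univ, Set.univ_inter, reduceCtorEq, if_false,
    add_zero] at key key'
  have pk := lt_of_le_of_ne (h.nonneg k) (Ne.symm hk0)
  have pb := lt_of_le_of_ne (h.nonneg (k + 1 + b)) (Ne.symm hb0)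
  have h0 := h.nonneg (k + 1)
  have h1 := h.nonneg (k + b)
  have h2 := hJ {e} {w | w ⟨e, Finset.mem_singleton_self e⟩ = true}
    (fun w w' hw hw1 => ?_) (({e}ᶜ : Finset E).restrict u) (({e}ᶜ : Finset E).restrict v)
    (fun e' => huv e') ?_ ?_
  · rw [condProb, condProb, key, key, key', key', h.eq, h.eq, h.eq, h.eq, hu', hu'', hv', hv'',
      div_le_div_iff₀ (by positivity) (by positivity)] at h2
    nlinarith [h2]
  · have := hw ⟨e, Finset.mem_singleton_self e⟩
    rw [Set.mem_ofPred_eq] at hw1 ⊢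
    rw [hw1] at this
    exact top_le_iff.1 this
  · rw [key', h.eq, h.eq, hu', hu'']; positivity
  · rw [key', h.eq, h.eq, hv', hv'']; positivity

theorem HNLC.NLC {μ : (E → Bool) → ℝ} (h : HNLC μ) : NLC μ := by
  have key : ∀ x : E → Bool, project μ univ ((univ : Finset E).restrict x) = μ x := by
    intro x
    rw [project, prob_eq_sum_ite, Finset.sum_eq_single x]
    · simp
    · intro y _ hy
      rw [if_neg]
      intro h1
      exact hy (funext fun e => congrFun h1 ⟨e, Finset.mem_univ e⟩)
    · simp
  intro x y
  have := h univ ((univ : Finset E).restrict x) ((univ : Finset E).restrict y)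
  rw [key, key] at this
  rw [← key, ← key (x ⊓ y)]
  exact this

/-! ### Log-concavity of the profile from CNA -/

/-- The mass of the configurations with prescribed values at two coordinates. -/
def pairMass (ν : (E → Bool) → ℝ) (e e' : E) (a b : Bool) : ℝ :=
  ∑ x, if x e = a ∧ x e' = b then ν x else 0

/-- Negative correlation of two coordinates in determinant form: for a 2×2 table of total mass 1,
p₁₁ ≤ (p₁₁+p₁₀)(p₁₁+p₀₁) is the same as p₁₁p₀₀ ≤ p₁₀p₀₁. -/
theorem NA.pairMass_mul_le {ν : (E → Bool) → ℝ} (h : NA ν) (h1 : ∑ x, ν x = 1) {e e' : E}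
    (hne : e ≠ e') : pairMass ν e e' true true * pairMass ν e e' false false ≤
      pairMass ν e e' true false * pairMass ν e e' false true := by
  have hm : e' ∈ ({e}ᶜ : Finset E) := by simpa using hne.symm
  have h2 := h {e} (fun w => if w ⟨e, Finset.mem_singleton_self e⟩ = true then 1 else 0)
    (fun z => if z ⟨e', hm⟩ = true then 1 else 0) (fun w w' hw => ?_) (fun w w' hw => ?_)
  · have e1 : expect ν (fun x => (if x e = true then 1 else 0) * (if x e' = true then 1 else 0)) =
        pairMass ν e e' true true := by
      refine Finset.sum_congr rfl fun x _ => ?_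
      cases h3 : x e <;> cases h4 : x e' <;> simp [h3, h4]
    have e2 : expect ν (fun x => if x e = true then 1 else 0) =
        pairMass ν e e' true true + pairMass ν e e' true false := by
      rw [pairMass, pairMass, ← Finset.sum_add_distrib]
      refine Finset.sum_congr rfl fun x _ => ?_
      cases h3 : x e <;> cases x e' <;> simp [h3]
    have e3 : expect ν (fun x => if x e' = true then 1 else 0) =
        pairMass ν e e' true true + pairMass ν e e' false true := by
      rw [pairMass, pairMass, ← Finset.sum_add_distrib]
      refine Finset.sum_congr rfl fun x _ => ?_
      cases x e <;> cases h4 : x e' <;> simp [h4]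
    have e4 : pairMass ν e e' true true + pairMass ν e e' true false +
        pairMass ν e e' false true + pairMass ν e e' false false = 1 := by
      rw [← h1]
      simp only [pairMass, ← Finset.sum_add_distrib]
      refine Finset.sum_congr rfl fun x _ => ?_
      cases x e <;> cases x e' <;> simp
    change expect ν (fun x => (if x e = true then 1 else 0) * (if x e' = true then 1 else 0)) ≤
      expect ν (fun x => if x e = true then 1 else 0) *
        expect ν (fun x => if x e' = true then 1 else 0) at h2
    rw [e1, e2, e3] at h2
    have e5 : pairMass ν e e' false false = 1 - (pairMass ν e e' true true +
      pairMass ν e e' true false + pairMass ν e e' false true) := by linarith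
    rw [e5]
    nlinarith [h2]
  · have := hw ⟨e, Finset.mem_singleton_self e⟩
    dsimp only
    cases h3 : w ⟨e, Finset.mem_singleton_self e⟩ <;>
      cases h4 : w' ⟨e, Finset.mem_singleton_self e⟩ <;> simp_all [not_true_le_false]
  · have := hw ⟨e', hm⟩
    dsimp only
    cases h3 : w ⟨e', hm⟩ <;> cases h4 : w' ⟨e', hm⟩ <;> simp_all [not_true_le_false]

theorem CNA.mul_le {μ : (E → Bool) → ℝ} (h : CNA μ) (h0 : ∀ x, 0 ≤ μ x) {u v : E → Bool}
    (hu : 0 < μ u) {e e' : E} (hne : e ≠ e') (hue : u e = false) (hue' : u e' = false)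
    (hve : v e = true) (hve' : v e' = true) :
    μ u * μ v ≤ pairMass ((agree (agreeSet u v) u).indicator μ) e e' true false *
      pairMass ((agree (agreeSet u v) u).indicator μ) e e' false true := by
  set A := agreeSet u v with hA
  set ν := (agree A u).indicator μ with hν
  have hν0 : ∀ x, 0 ≤ ν x := fun x => Set.indicator_nonneg (fun x _ => h0 x) x
  have hνu : ν u = μ u := Set.indicator_of_mem (show u ∈ agree A u from fun e _ => rfl) _
  have hνv : ν v = μ v := Set.indicator_of_mem (show v ∈ agree A u from fun e he => by
    simp only [hA, agreeSet, Finset.mem_filter] at he; exact he.2.symm) _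
  have hle : ∀ (x : E → Bool) (a b : Bool), x e = a → x e' = b → ν x ≤ pairMass ν e e' a b := by
    intro x a b hxa hxb
    calc ν x = if x e = a ∧ x e' = b then ν x else 0 := (if_pos ⟨hxa, hxb⟩).symm
      _ ≤ _ := Finset.single_le_sum (f := fun x => if x e = a ∧ x e' = b then ν x else 0)
        (fun x _ => by split_ifs; exacts [hν0 x, le_rfl]) (Finset.mem_univ x)
  have hZ : 0 < prob μ (agree A u) :=
    lt_of_lt_of_le (hνu ▸ hu) (Finset.single_le_sum (f := ν) (fun x _ => hν0 x) (Finset.mem_univ u))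
  have hp : ∀ a b, pairMass (condition μ A u) e e' a b =
      pairMass ν e e' a b / prob μ (agree A u) := by
    intro a b
    rw [pairMass, pairMass, Finset.sum_div]
    refine Finset.sum_congr rfl fun x _ => ?_
    split_ifs
    · rfl
    · rw [zero_div]
  have h1 := (h A u hZ).pairMass_mul_le (sum_condition hZ) hne
  rw [hp, hp, hp, hp, div_mul_div_comm, div_mul_div_comm,
    div_le_div_iff_of_pos_right (mul_pos hZ hZ)] at h1
  have h2 := mul_le_mul (hle u _ _ hue hue') (hle v _ _ hve hve') (hν0 v)
    ((hν0 u).trans (hle u _ _ hue hue'))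
  rw [hνu, hνv] at h2
  linarith

theorem pairMass_comm (ν : (E → Bool) → ℝ) (e e' : E) (a b : Bool) :
    pairMass ν e e' a b = pairMass ν e' e b a := by
  simp only [pairMass, and_comm]

theorem IsProfile.exists_ne_zero_of_CNA {μ : (E → Bool) → ℝ} {q : ℕ → ℝ} (h : IsProfile μ q)
    (hC : CNA μ) {i l : ℕ} (hil : i + 2 ≤ l) (hi : q i ≠ 0) (hl : q l ≠ 0) :
    ∃ j, i < j ∧ j < l ∧ q j ≠ 0 := by
  have hln : l ≤ Fintype.card E := not_lt.1 fun h1 => hl (h.eq_zero _ h1)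
  obtain ⟨u, v, e, e', huv, hne, hue, hue', hve, hve', hu, hv⟩ := exists_pair_of_two_le hil hln
  have h0 : ∀ x, 0 ≤ μ x := fun x => h.eq x ▸ h.nonneg _
  have pi : 0 < q i := lt_of_le_of_ne (h.nonneg i) (Ne.symm hi)
  have pl : 0 < q l := lt_of_le_of_ne (h.nonneg l) (Ne.symm hl)
  have h1 := hC.mul_le h0 (v := v) (by rw [h.eq, hu]; exact pi) hne hue hue' hve hve'
  rw [h.eq, h.eq, hu, hv] at h1
  have h2 : pairMass ((agree (agreeSet u v) u).indicator μ) e e' true false ≠ 0 := by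
    intro h3
    rw [h3, zero_mul] at h1
    exact (mul_pos pi pl).not_ge h1
  obtain ⟨x, -, hx⟩ := Finset.exists_ne_zero_of_sum_ne_zero h2
  obtain ⟨⟨hxe, hxe'⟩, hx⟩ : (x e = true ∧ x e' = false) ∧
      (agree (agreeSet u v) u).indicator μ x ≠ 0 := by
    by_cases hc : x e = true ∧ x e' = false
    · rw [if_pos hc] at hx; exact ⟨hc, hx⟩
    · rw [if_neg hc] at hx; exact absurd rfl hx
  have hmem := Set.mem_of_indicator_ne_zero hx
  rw [Set.indicator_of_mem hmem, h.eq] at hx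
  obtain ⟨h3, h4⟩ := le_of_mem_agree huv hmem
  -- Since `x` has a one at `e` and a zero at `e'`, dropping `e` keeps it above `u` and adding `e'`
  -- keeps it below `v`; hence its rank is strictly between theirs.
  have h5 := cnt_update_false hxe
  have h6 := cnt_update_true hxe'
  have h7 : cnt u ≤ cnt (Function.update x e false) :=
    cnt_mono (le_update_iff.2 ⟨hue.le, fun e' _ => h3 e'⟩)
  have h8 : cnt (Function.update x e' true) ≤ cnt v :=
    cnt_mono (update_le_iff.2 ⟨hve'.ge, fun e' _ => h4 e'⟩)
  exact ⟨cnt x, by omega, by omega, hx⟩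

/-- With a rank gap of two, `e` and `e'` are the only free coordinates, so the prescribed values
leave a single configuration. -/
theorem pairMass_le_of_cnt_eq {μ : (E → Bool) → ℝ} (h0 : ∀ x, 0 ≤ μ x) {u v : E → Bool}
    {e e' : E} (huv : u ≤ v) (hne : e ≠ e') (hue : u e = false) (hue' : u e' = false)
    (hve : v e = true) (hve' : v e' = true) (hc : cnt v = cnt u + 2) :
    pairMass ((agree (agreeSet u v) u).indicator μ) e e' true false ≤
      μ (Function.update u e true) := by
  have h1 : μ (Function.update u e true) =
      ∑ x, if x = Function.update u e true then μ x else 0 := by simp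
  rw [h1, pairMass]
  refine Finset.sum_le_sum fun x _ => ?_
  have hnn : 0 ≤ if x = Function.update u e true then μ x else 0 := by
    split_ifs
    exacts [h0 x, le_rfl]
  by_cases hx : x e = true ∧ x e' = false
  · rw [if_pos hx]
    by_cases hm : x ∈ agree (agreeSet u v) u
    · rw [Set.indicator_of_mem hm, if_pos]
      have hex : (univ.filter fun a => u a = false ∧ v a = true) = {e, e'} := by
        symm
        refine Finset.eq_of_subset_of_card_le ?_ ?_
        · intro a ha
          rcases Finset.mem_insert.1 ha with rfl | ha
          · simp [hue, hve]
          · rw [Finset.mem_singleton.1 ha]; simp [hue', hve']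
        · have h2 := excess_add_cnt u v
          have h3 := excess_eq_zero huv
          rw [Finset.card_pair hne]
          exact (show excess u v ≤ 2 by omega)
      ext a
      by_cases ha : a = e
      · subst ha; simp [hx.1]
      by_cases ha' : a = e'
      · subst ha'; simp [hx.2, ha, hue']
      have h4 : ¬(u a = false ∧ v a = true) := fun h => by
        have : a ∈ univ.filter fun a => u a = false ∧ v a = true := by simp [h]
        rw [hex] at this
        simp [ha, ha'] at this
      have h5 : u a = v a := by
        have := huv a
        clear hex
        cases h6 : u a <;> cases h7 : v a <;> simp_all [not_true_le_false]
      rw [hm a (by simp [agreeSet, h5])]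
      simp [ha]
    · rw [Set.indicator_of_notMem hm]; exact hnn
  · rw [if_neg hx]; exact hnn

theorem ordConnected_of_exists_between {q : ℕ → ℝ}
    (h : ∀ i l, i + 2 ≤ l → q i ≠ 0 → q l ≠ 0 → ∃ j, i < j ∧ j < l ∧ q j ≠ 0) :
    {k | q k ≠ 0}.OrdConnected := by
  suffices H : ∀ d i l j, l ≤ i + d → q i ≠ 0 → q l ≠ 0 → i ≤ j → j ≤ l → q j ≠ 0 from
    ⟨fun i hi l hl j hj => H l i l j (by omega) hi hl hj.1 hj.2⟩
  intro d
  induction d with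
  | zero =>
    intro i l j hd hi hl hij hjl
    rwa [show j = i by omega]
  | succ d ih =>
    intro i l j hd hi hl hij hjl
    by_cases hil : i + 2 ≤ l
    · obtain ⟨m, him, hml, hm⟩ := h i l hil hi hl
      rcases le_total j m with hjm | hjm
      · exact ih i m j (by omega) hi hm hij hjm
      · exact ih m l j (by omega) hm hl hjm hjl
    · rcases (show j = i ∨ j = l by omega) with rfl | rfl
      exacts [hi, hl]

/-- Across a long gap CNA bounds q(i)q(l) only by sums over many intermediate configurations. This
suffices to exclude internal zeros, and a gap of exactly two then supplies the local inequality. -/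
theorem IsProfile.logConcave_of_CNA {μ : (E → Bool) → ℝ} {q : ℕ → ℝ} (h : IsProfile μ q)
    (hC : CNA μ) : LogConcave q := by
  refine .of_ordConnected h.nonneg
    (ordConnected_of_exists_between fun i l hil hi hl => h.exists_ne_zero_of_CNA hC hil hi hl)
    fun k => ?_
  by_cases hk0 : q k = 0
  · rw [hk0, zero_mul]; exact sq_nonneg _
  by_cases hk2 : q (k + 2) = 0
  · rw [hk2, mul_zero]; exact sq_nonneg _
  have hln : k + 2 ≤ Fintype.card E := not_lt.1 fun h1 => hk2 (h.eq_zero _ h1)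
  obtain ⟨u, v, e, e', huv, hne, hue, hue', hve, hve', hu, hv⟩ :=
    exists_pair_of_two_le le_rfl hln
  have h0 : ∀ x, 0 ≤ μ x := fun x => h.eq x ▸ h.nonneg _
  have pk : 0 < q k := lt_of_le_of_ne (h.nonneg k) (Ne.symm hk0)
  have h1 := hC.mul_le h0 (v := v) (by rw [h.eq, hu]; exact pk) hne hue hue' hve hve'
  have h2 := pairMass_le_of_cnt_eq h0 huv hne hue hue' hve hve' (by omega)
  have h3 := pairMass_le_of_cnt_eq h0 huv hne.symm hue' hue hve' hve (by omega)
  rw [pairMass_comm] at h3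
  rw [h.eq, cnt_update_true hue, hu] at h2
  rw [h.eq, cnt_update_true hue', hu] at h3
  rw [h.eq, h.eq, hu, hv] at h1
  refine h1.trans ?_
  rw [sq]
  refine mul_le_mul h2 h3 (Finset.sum_nonneg fun x _ => ?_) (h.nonneg _)
  split_ifs
  exacts [Set.indicator_nonneg (fun x _ => h0 x) x, le_rfl]

end Exchangeable

end NegDep

theorem mainTheorem2 {E : Type*} [Fintype E] [DecidableEq E] (μ : (E → Bool) → ℝ)
    (hμ : NegDep.IsProb μ) (hex : NegDep.Exchangeable μ) :
    List.TFAE [NegDep.CNAPlus μ, NegDep.JNRDPlus μ, NegDep.HNLCPlus μ,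
      NegDep.CNA μ, NegDep.JNRD μ, NegDep.HNLC μ,
      NegDep.ULC (Fintype.card E) (NegDep.rankSeq μ), NegDep.NLC μ] := by
  obtain ⟨q, hq⟩ := hex.exists_isProfile hμ.1
  rw [hq.ULC_iff]
  tfae_have 7 → 1 := fun h => (hq.isWeightedSymmetric h).CNAPlus
  tfae_have 7 → 2 := fun h => (hq.isWeightedSymmetric h).JNRDPlus
  tfae_have 7 → 3 := fun h => (hq.isWeightedSymmetric h).HNLCPlus
  tfae_have 1 → 4 := fun h => h.1
  tfae_have 2 → 5 := fun h => h.1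
  tfae_have 3 → 6 := fun h => h.1
  tfae_have 4 → 7 := hq.logConcave_of_CNA
  tfae_have 5 → 7 := hq.logConcave_of_JNRD
  tfae_have 6 → 8 := NegDep.HNLC.NLC
  tfae_have 8 → 7 := hq.logConcave_of_NLC
  tfae_finish
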